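/- Let $Y$ be a finite CW complex with $\dim Y > 3$ and let $n \ge 2$ be an integer. Then, for any finite CW complex $X$ with $\dim X \ge 1$, there exists a unital $*$-homomorphism $\phi : C(X) \to C(Y, M_n)$ which cannot be approximately diagonalized. Here $C(X)$ is the C*-algebra of continuous complex-valued functions on $X$, and $C(Y,M_n)$ is the C*-algebra of continuous functions from $Y$ to the complex $n\times n$ matrices, with the supremum of the operator norms as norm. A unital $*$-homomorphism $\phi : C(X) \to C(Y, M_n)$ can be *approximately diagonalized* if for every $\varepsilon > 0$ and every compact set $\mathcal F \subset C(X)$ there are continuous maps $\alpha_1,\dots,\alpha_n : Y \to X$ and mutually orthogonal projections $p_1,\dots,p_n \in C(Y,M_n)$, with $p_i(y)$ of rank one for every $y \in Y$, such that $$\Big\|\phi(f) - \sum_{i=1}^n f(\alpha_i)\,p_i\Big\| < \varepsilon \quad\text{for all } f \in \mathcal F,$$ where $f(\alpha_i) = f\circ\alpha_i \in C(Y)$. -/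

import Mathlib

open Topology
open scoped Matrix.Norms.L2Operator

/-- The dimension of a CW complex: the supremum of the dimensions of its cells
(`⊥` for the empty complex). -/
noncomputable def cwDim {X : Type*} [TopologicalSpace X] (C : Set X) [CWComplex C] :
    WithBot ℕ∞ :=
  ⨆ (d : ℕ) (_ : Nonempty (RelCWComplex.cell C d)), ((d : ℕ∞) : WithBot ℕ∞)

/-- A finite CW complex is a compact space. -/
instance compactSpace_of_finite_cwComplex {X : Type*} [TopologicalSpace X] [T2Space X]
    [CWComplex (Set.univ : Set X)] [RelCWComplex.Finite (Set.univ : Set X)] :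
    CompactSpace X := by
  have hfin := RelCWComplex.finite_cells_of_finite (C := (Set.univ : Set X))
  have hU : (⋃ p : Σ n, RelCWComplex.cell (Set.univ : Set X) n,
      RelCWComplex.closedCell p.1 p.2) = (Set.univ : Set X) := by
    rw [Set.iUnion_sigma]
    exact CWComplex.union
  constructor
  rw [← hU]
  exact isCompact_iUnion fun p => RelCWComplex.isCompact_closedCell

/-- `φ : C(X) → C(Y, M_n)` is approximately diagonalizable: for every `ε > 0` and every compact
`F ⊆ C(X)` there are continuous maps `α₁, …, αₙ : Y → X` and mutually orthogonal rank one
projections `p₁, …, pₙ ∈ C(Y, M_n)` (projections all of whose fibres have rank one) with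
`‖φ(f) - ∑ᵢ (f ∘ αᵢ) pᵢ‖ < ε` for all `f ∈ F`. Matrices carry the C*-norm (the operator norm on
`ℂⁿ` with its Euclidean norm) and `C(Y, M_n)` the corresponding supremum norm. -/
def IsApproxDiagonalizable {X Y : Type*} [TopologicalSpace X] [CompactSpace X]
    [TopologicalSpace Y] [CompactSpace Y] {n : ℕ}
    (φ : C(X, ℂ) →⋆ₐ[ℂ] C(Y, Matrix (Fin n) (Fin n) ℂ)) : Prop :=
  ∀ ε : ℝ, 0 < ε → ∀ F : Set C(X, ℂ), IsCompact F →
    ∃ (α : Fin n → C(Y, X)) (p : Fin n → C(Y, Matrix (Fin n) (Fin n) ℂ)),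
      (∀ i, IsStarProjection (p i)) ∧ (∀ i y, (p i y).rank = 1) ∧
      (∀ i j, i ≠ j → p i * p j = 0) ∧
      ∀ f ∈ F, ‖φ f - ∑ i, (f.comp (α i)) • p i‖ < ε

/-! On the unit sphere of `ℝ³` the 1-eigenspaces of `[[t, z̄], [z, -t]] ⊕ 0` form the Hopf line
bundle, which has no nonvanishing section (`exists_hopf_section_eq_zero`). The matrix field itself
extends over the ball, and from a copy of the ball in a cell of Y to a self-adjoint `a` in `C(Y,
M_n)`. If `∑ β i • p i` is close to `a`, some `β i` is near 1 at a pole. Over the sphere the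
spectrum of `a` lies in {1, -1, 0}, so by connectedness this `β i` stays near 1 there. Over the
contractible ball the range of `p i` has a nonvanishing section, and its component in the
1-eigenspace would be a nonvanishing section of the Hopf bundle (`exists_le_norm_sub_sum_smul`).
Since X contains an arc, functional calculus makes `a` a value of some `φ`, and a single function
then obstructs diagonalization. -/

/-! ### Embedding balls in cells -/

/-- A continuous injection of a finite-dimensional space into a compact Hausdorff space has a
continuous left inverse on every compact set. -/
theorem exists_leftInverse_on_compact.{u} {F : Type*} {Y : Type u} [TopologicalSpace F] [T2Space F]
    [TietzeExtension.{u} F] [TopologicalSpace Y] [T2Space Y] [CompactSpace Y]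
    (f : C(F, Y)) (hf : Function.Injective f) {K : Set F} (hK : IsCompact K) :
    ∃ h : C(Y, F), ∀ x ∈ K, h (f x) = x := by
  have := isCompact_iff_compactSpace.mp hK
  let e : K → Y := fun x => f x
  have he : IsClosedEmbedding e :=
    (f.continuous.comp continuous_subtype_val).isClosedEmbedding
      (hf.comp Subtype.val_injective)
  obtain ⟨h, hh⟩ := ContinuousMap.exists_extension he
    (⟨Subtype.val, continuous_subtype_val⟩ : C(K, F))
  exact ⟨h, fun x hx => DFunLike.congr_fun hh ⟨x, hx⟩⟩

/-- A CW complex with a cell of dimension at least `k` contains an injective continuous image of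
every space that embeds linearly in `ℝ^k`. -/
theorem exists_injective_of_cell {X : Type*} [TopologicalSpace X] {C : Set X} [CWComplex C]
    {d : ℕ} (e : RelCWComplex.cell C d) {F : Type*} [TopologicalSpace F]
    (L : F → Fin d → ℝ) (hL : Continuous L) (hLi : Function.Injective L) :
    ∃ f : C(F, X), Function.Injective f := by
  let b := Homeomorph.unitBall (E := Fin d → ℝ)
  refine ⟨⟨fun x => RelCWComplex.map d e (b (L x)), ?_⟩, ?_⟩
  · exact (RelCWComplex.continuousOn d e).comp_continuous
      (continuous_subtype_val.comp (b.continuous.comp hL))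
      (fun x => Metric.ball_subset_closedBall (b (L x)).2)
  · intro x y hxy
    refine hLi (b.injective (Subtype.ext ((RelCWComplex.map d e).injOn ?_ ?_ hxy)))
    · rw [RelCWComplex.source_eq]; exact (b (L x)).2
    · rw [RelCWComplex.source_eq]; exact (b (L y)).2

/-- The zero padding map `ℝ^k → ℝ^d` is continuous and injective for `k ≤ d`. -/
theorem exists_continuous_injective_pad {k d : ℕ} (hkd : k ≤ d) :
    ∃ L : (Fin k → ℝ) → Fin d → ℝ, Continuous L ∧ Function.Injective L := by
  refine ⟨fun x i => if h : (i : ℕ) < k then x ⟨i, h⟩ else 0, ?_, ?_⟩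
  · refine continuous_pi fun i => ?_
    by_cases h : (i : ℕ) < k
    · simpa only [h, dite_true] using continuous_apply _
    · simpa only [h, dite_false] using continuous_const
  · intro x y hxy
    ext i
    have := congrFun hxy (Fin.castLE hkd i)
    simpa using this

/-! ### Winding number and nonvanishing sections -/

/-- There is no nowhere vanishing continuous function on `ℂ` which is the identity on the unit
circle. -/
theorem exists_eq_zero_of_eq_id_on_circle {c : ℂ → ℂ} (hc : Continuous c)
    (h1 : ∀ z, ‖z‖ = 1 → c z = z) : ∃ z, c z = 0 := by
  by_contra! h0
  obtain ⟨L, ⟨-, hL⟩, -⟩ := Complex.isCoveringMapOn_exp.existsUnique_continuousMap_lifts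
    (⟨c, hc⟩ : C(ℂ, ℂ)) (a₀ := 0) (e₀ := Complex.log (c 0)) (by simp [Complex.exp_log (h0 0)])
    (by intro x; simpa using h0 x)
  have hL' : ∀ z, Complex.exp (L z) = c z := fun z => congrFun hL z
  -- A logarithm of `c` differs from `iθ` on the circle by a constant in `2πiℤ`, yet `L` takes equal
  -- values at `θ = 0` and `θ = 2π`.
  let k : ℝ → ℂ := fun θ => (L (Complex.exp (θ * Complex.I)) - θ * Complex.I)
  have hk : Continuous k := by fun_prop
  have hexp : ∀ θ, Complex.exp (k θ) = 1 := by
    intro θ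
    simp only [k]
    rw [Complex.exp_sub, hL', h1 _ (Complex.norm_exp_ofReal_mul_I θ), div_self (Complex.exp_ne_zero _)]
  choose m hm using fun θ => Complex.exp_eq_one_iff.mp (hexp θ)
  have hpi : (2 * Real.pi * Complex.I : ℂ) ≠ 0 := by simp [Real.pi_ne_zero]
  have hmc : Continuous m := by
    rw [Int.isClosedEmbedding_coe_real.isInducing.continuous_iff]
    have : ((↑) : ℤ → ℝ) ∘ m = fun θ => (k θ / (2 * Real.pi * Complex.I)).re := by
      ext θ
      rw [hm, mul_div_cancel_right₀ _ hpi]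
      simp
    rw [this]
    fun_prop
  have hmm : m 0 = m (2 * Real.pi) := PreconnectedSpace.constant inferInstance hmc
  have h2 : k 0 = k (2 * Real.pi) := by rw [hm, hm, hmm]
  simp only [k] at h2
  push_cast at h2
  rw [Complex.exp_two_pi_mul_I] at h2
  simp only [zero_mul, Complex.exp_zero, sub_zero] at h2
  exact hpi (sub_eq_self.mp h2.symm)

/-- A continuous field of idempotents on a real normed space has a section which does not vanish on
a given ball, as soon as the idempotent at the centre is nonzero. -/
theorem exists_nonvanishing_section {E H : Type*} [NormedAddCommGroup E] [NormedSpace ℝ E]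
    [ProperSpace E] [NormedAddCommGroup H] [NormedSpace ℂ H]
    {P : E → H →L[ℂ] H} (hP : Continuous P) (hPi : ∀ x, P x * P x = P x) (h0 : P 0 ≠ 0) :
    ∃ v : E → H, Continuous v ∧ (∀ x, P x (v x) = v x) ∧ ∀ x, ‖x‖ ≤ 1 → v x ≠ 0 := by
  -- Transport a vector radially in `N` steps, each so short that consecutive idempotents differ by
  -- less than 1 in norm.
  have huc := (isCompact_closedBall (0 : E) 1).uniformContinuousOn_of_continuous hP.continuousOn
  obtain ⟨δ, hδ, hd⟩ := Metric.uniformContinuousOn_iff.mp huc 1 one_pos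
  obtain ⟨N, hN⟩ := exists_nat_gt (1 / δ)
  have hNpos : (0 : ℝ) < N := (by positivity : 0 < 1 / δ).trans hN
  have key : ∀ k : ℕ, k ≤ N → ∃ v : E → H, Continuous v ∧
      (∀ x, P (((k : ℝ) / N) • x) (v x) = v x) ∧ ∀ x, ‖x‖ ≤ 1 → v x ≠ 0 := by
    intro k
    induction k with
    | zero =>
      intro _
      obtain ⟨u, hu⟩ : ∃ u, P 0 u ≠ 0 := by
        by_contra! h
        exact h0 (ContinuousLinearMap.ext h)
      refine ⟨fun _ => P 0 u, continuous_const, fun x => ?_, fun _ _ => hu⟩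
      simpa using DFunLike.congr_fun (hPi 0) u
    | succ k ih =>
      intro hk
      obtain ⟨v, hv, hPv, hne⟩ := ih (by omega)
      refine ⟨fun x => P ((((k + 1 : ℕ) : ℝ) / N) • x) (v x), by fun_prop,
        fun x => DFunLike.congr_fun (hPi _) (v x), fun x hx h => hne x hx ?_⟩
      have hmem : ∀ j : ℕ, j ≤ N → ((j : ℝ) / N) • x ∈ Metric.closedBall (0 : E) 1 := by
        intro j hj
        rw [mem_closedBall_zero_iff, norm_smul, Real.norm_of_nonneg (by positivity)]
        have : (j : ℝ) / N ≤ 1 := (div_le_one hNpos).mpr (by exact_mod_cast hj)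
        exact mul_le_one₀ this (norm_nonneg _) hx
      have hdist : dist (((k : ℝ) / N) • x) ((((k + 1 : ℕ) : ℝ) / N) • x) < δ := by
        rw [dist_eq_norm, ← sub_smul, norm_smul]
        have : (k : ℝ) / N - ((k + 1 : ℕ) : ℝ) / N = -(1 / N) := by push_cast; ring
        rw [this, norm_neg, Real.norm_of_nonneg (by positivity)]
        calc 1 / (N : ℝ) * ‖x‖ ≤ 1 / N * 1 := by gcongr
          _ < δ := by
            rw [mul_one, div_lt_iff₀ hNpos]
            rwa [div_lt_iff₀ hδ, mul_comm] at hN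
      have hlt := hd _ (hmem k (by omega)) _ (hmem (k + 1) hk) hdist
      rw [dist_eq_norm] at hlt
      -- If the next idempotent killed `v x`, then `v x` would be the image of itself under an
      -- operator of norm less than 1.
      have hle := (P (((k : ℝ) / N) • x) - P ((((k + 1 : ℕ) : ℝ) / N) • x)).le_opNorm (v x)
      rw [sub_apply, hPv, show P _ (v x) = 0 from h, sub_zero] at hle
      by_contra hv0
      have := mul_lt_mul_of_pos_right hlt (norm_pos_iff.mpr hv0)
      linarith
  obtain ⟨v, hv, hPv, hne⟩ := key N le_rfl
  refine ⟨v, hv, fun x => ?_, hne⟩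
  simpa [div_self hNpos.ne'] using hPv x

/-! ### Approximate eigenvalues -/

/-- If `A` is close to `∑ β i • p i` for orthogonal idempotents `p i` of norm at most one, then some
`β i` is close to any given eigenvalue of `A`; here the eigenvalue is `1`. -/
theorem exists_coeff_near_one {H : Type*} [NormedAddCommGroup H] [NormedSpace ℂ H] {n : ℕ}
    {A : H →L[ℂ] H} {p : Fin n → H →L[ℂ] H} {β : Fin n → ℂ} {ε : ℝ}
    (hpi : ∀ i, p i * p i = p i) (hpo : ∀ i j, i ≠ j → p i * p j = 0) (hp1 : ∀ i, ‖p i‖ ≤ 1)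
    (hA : ‖A - ∑ i, β i • p i‖ ≤ ε) (hε : (3 * n + 1) * ε < 1) {e : H} (he : e ≠ 0)
    (hAe : A e = e) : ∃ i, ‖β i - 1‖ < 1 / 2 := by
  by_contra! hβ
  have hβ0 : ∀ i, β i - 1 ≠ 0 := fun i h => by
    have := hβ i
    rw [h, norm_zero] at this
    norm_num at this
  let B := ∑ i, β i • p i
  -- A left inverse of `B - 1`: on the common kernel of the `p i`, `B` vanishes, hence the sign. Its
  -- norm is at most `2n + (1 + n)`.
  let C : H →L[ℂ] H := ∑ i, (β i - 1)⁻¹ • p i - (1 - ∑ i, p i)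
  have hpB : ∀ i, p i * (B - 1) = (β i - 1) • p i := by
    intro i
    rw [mul_sub, Finset.mul_sum, mul_one, sub_smul, one_smul,
      Finset.sum_eq_single i (fun j _ hj => by rw [mul_smul_comm, hpo i j hj.symm, smul_zero])
        (by simp), mul_smul_comm, hpi]
  have hCB : C * (B - 1) = 1 := by
    have h1 : (∑ i, (β i - 1)⁻¹ • p i) * (B - 1) = ∑ i, p i := by
      rw [Finset.sum_mul]
      refine Finset.sum_congr rfl fun i _ => ?_
      rw [smul_mul_assoc, hpB, smul_smul, inv_mul_cancel₀ (hβ0 i), one_smul]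
    have h2 : (∑ i, p i) * (B - 1) = B - ∑ i, p i := by
      rw [Finset.sum_mul, ← Finset.sum_sub_distrib]
      refine Finset.sum_congr rfl fun i _ => ?_
      rw [hpB, sub_smul, one_smul]
    simp only [C]
    rw [sub_mul, sub_mul, h1, h2, one_mul]
    abel
  have hC : ‖C‖ ≤ 3 * n + 1 := by
    have h1 : ‖∑ i, (β i - 1)⁻¹ • p i‖ ≤ ∑ _i : Fin n, (2 : ℝ) := by
      refine norm_sum_le_of_le _ fun i _ => ?_
      rw [norm_smul, norm_inv]
      have : ‖β i - 1‖⁻¹ ≤ 2 := by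
        rw [inv_le_comm₀ (by linarith [hβ i]) two_pos]
        linarith [hβ i]
      nlinarith [hp1 i, norm_nonneg (p i)]
    have h2 : ‖∑ i, p i‖ ≤ ∑ _i : Fin n, (1 : ℝ) := norm_sum_le_of_le _ fun i _ => hp1 i
    have h3 : ‖(1 : H →L[ℂ] H)‖ ≤ 1 := ContinuousLinearMap.norm_id_le
    simp only [Finset.sum_const, Finset.card_univ, Fintype.card_fin, nsmul_eq_mul] at h1 h2
    have h4 := norm_sub_le (∑ i, (β i - 1)⁻¹ • p i) (1 - ∑ i, p i)
    have h5 := norm_sub_le 1 (∑ i, p i)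
    simp only [C]
    linarith
  have hBe : ‖(B - 1) e‖ ≤ ε * ‖e‖ := by
    have h1 := (A - B).le_opNorm e
    have h2 : (B - 1) e = -((A - B) e) := by
      simp [hAe]
    rw [h2, norm_neg]
    exact h1.trans (by gcongr)
  have hle : ‖e‖ ≤ (3 * n + 1) * (ε * ‖e‖) := by
    calc ‖e‖ = ‖C ((B - 1) e)‖ := by
          change _ = ‖(C * (B - 1)) e‖
          rw [hCB]
          rfl
      _ ≤ ‖C‖ * ‖(B - 1) e‖ := C.le_opNorm _
      _ ≤ _ := by gcongr
  have := mul_lt_mul_of_pos_right hε (norm_pos_iff.mpr he)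
  linarith

theorem Complex.norm_bounds_of_norm_sub_one_le_half {β : ℂ} (hβ : ‖β - 1‖ ≤ 1 / 2) :
    1 / 2 ≤ ‖β‖ ∧ ‖β‖ ≤ 3 / 2 ∧ 3 / 2 ≤ ‖β + 1‖ ∧ ‖β + 1‖ ≤ 5 / 2 := by
  have h1 := norm_sub_norm_le (1 : ℂ) (1 - β)
  have h2 := norm_add_le (1 : ℂ) (β - 1)
  have h3 := norm_sub_norm_le (2 : ℂ) (1 - β)
  have h4 := norm_add_le (2 : ℂ) (β - 1)
  rw [norm_sub_rev 1 β] at h1 h3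
  rw [show (1 : ℂ) - (1 - β) = β by ring] at h1
  rw [show (1 : ℂ) + (β - 1) = β by ring] at h2
  rw [show (2 : ℂ) - (1 - β) = β + 1 by ring] at h3
  rw [show (2 : ℂ) + (β - 1) = β + 1 by ring] at h4
  have h5 : ‖(2 : ℂ)‖ = 2 := by simp
  rw [norm_one] at h1 h2
  rw [h5] at h3 h4
  refine ⟨?_, ?_, ?_, ?_⟩ <;> linarith

/-- An operator with spectrum in `{1, -1, 0}` has no approximate eigenvalue at distance `1 / 2`
from `1`. -/
theorem norm_sub_one_ne_half {H : Type*} [NormedAddCommGroup H] [NormedSpace ℂ H]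
    {A : H →L[ℂ] H} {β : ℂ} {ε M : ℝ} (hA3 : A * A * A = A) (hAM : ‖A‖ ≤ M)
    (hε : (M ^ 2 + 3 * M + 4) * ε < 3 / 8) {v : H} (hv : v ≠ 0)
    (hAv : ‖A v - β • v‖ ≤ ε * ‖v‖) : ‖β - 1‖ ≠ 1 / 2 := by
  intro hβ
  obtain ⟨b1, b2, b3, b4⟩ := Complex.norm_bounds_of_norm_sub_one_le_half hβ.le
  have hM : 0 ≤ M := (norm_nonneg A).trans hAM
  set r := A v - β • v with hr
  have hAv' : A v = β • v + r := by rw [hr]; abel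
  have h3 : A (A (A v)) = A v := DFunLike.congr_fun hA3 v
  -- Substituting `A v = β v + r` in `A³ v = A v` bounds `β³ - β` by the error, while `|β³ - β| ≥
  -- 1/2 · 1/2 · 3/2 = 3/8`.
  have hid : (β * (β - 1) * (β + 1)) • v = r - (β ^ 2 • r + β • A r + A (A r)) := by
    rw [hAv'] at h3
    simp only [map_add, map_smul, hAv'] at h3
    rw [← sub_eq_zero] at h3 ⊢
    rw [← h3]
    module
  have hAr : ∀ w, ‖A w‖ ≤ M * ‖w‖ := fun w => (A.le_opNorm w).trans (by gcongr)
  have hup : ‖r - (β ^ 2 • r + β • A r + A (A r))‖ ≤ (M ^ 2 + 3 * M + 4) * ‖r‖ := by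
    calc _ ≤ ‖r‖ + (‖β ^ 2 • r‖ + ‖β • A r‖ + ‖A (A r)‖) :=
          (norm_sub_le _ _).trans (by gcongr; exact norm_add₃_le)
      _ ≤ ‖r‖ + ((3 / 2) ^ 2 * ‖r‖ + 3 / 2 * (M * ‖r‖) + M * (M * ‖r‖)) := by
          rw [norm_smul, norm_smul, norm_pow]
          gcongr
          · exact hAr r
          · exact (hAr _).trans (by gcongr; exact hAr r)
      _ ≤ _ := by nlinarith [norm_nonneg r, mul_nonneg hM (norm_nonneg r)]
  rw [← hid, norm_smul, norm_mul, norm_mul, hβ] at hup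
  have hvp := norm_pos_iff.mpr hv
  have hlow : 3 / 8 ≤ ‖β‖ * (1 / 2) * ‖β + 1‖ := by nlinarith
  have h4 : (M ^ 2 + 3 * M + 4) * ‖r‖ ≤ (M ^ 2 + 3 * M + 4) * (ε * ‖v‖) := by gcongr
  nlinarith [mul_lt_mul_of_pos_right hε hvp, mul_le_mul_of_nonneg_right hlow hvp.le]

/-- An approximate eigenvector for an approximate eigenvalue near `1` of an operator with spectrum
in `{1, -1, 0}` has nonzero component in the `1`-eigenspace. -/
theorem sq_add_self_apply_ne_zero {H : Type*} [NormedAddCommGroup H] [NormedSpace ℂ H]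
    {A : H →L[ℂ] H} {β : ℂ} {ε M : ℝ} (hAM : ‖A‖ ≤ M)
    (hε : (M ^ 2 + 3 * M + 4) * ε < 3 / 8) {v : H} (hv : v ≠ 0)
    (hAv : ‖A v - β • v‖ ≤ ε * ‖v‖) (hβ : ‖β - 1‖ < 1 / 2) : A (A v) + A v ≠ 0 := by
  intro h0
  obtain ⟨b1, b2, b3, b4⟩ := Complex.norm_bounds_of_norm_sub_one_le_half hβ.le
  have hM : 0 ≤ M := (norm_nonneg A).trans hAM
  set r := A v - β • v with hr
  have hAv' : A v = β • v + r := by rw [hr]; abel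
  have hid : (β * (β + 1)) • v = - ((β + 1) • r + A r) := by
    rw [hAv'] at h0
    simp only [map_add, map_smul, hAv'] at h0
    rw [← sub_eq_zero, ← h0]
    module
  have hup : ‖-((β + 1) • r + A r)‖ ≤ (M ^ 2 + 3 * M + 4) * ‖r‖ := by
    rw [norm_neg]
    calc _ ≤ ‖(β + 1) • r‖ + ‖A r‖ := norm_add_le _ _
      _ ≤ 5 / 2 * ‖r‖ + M * ‖r‖ := by
          rw [norm_smul]
          gcongr
          exact (A.le_opNorm r).trans (by gcongr)
      _ ≤ _ := by nlinarith [norm_nonneg r, mul_nonneg hM (norm_nonneg r), sq_nonneg M]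
  rw [← hid, norm_smul, norm_mul] at hup
  have hvp := norm_pos_iff.mpr hv
  have hlow : 3 / 8 ≤ ‖β‖ * ‖β + 1‖ := by nlinarith
  have h4 : (M ^ 2 + 3 * M + 4) * ‖r‖ ≤ (M ^ 2 + 3 * M + 4) * (ε * ‖v‖) := by gcongr
  nlinarith [mul_lt_mul_of_pos_right hε hvp, mul_le_mul_of_nonneg_right hlow hvp.le]

/-! ### The Hopf bundle and the hedgehog field -/

/-- The complex coordinate `x₁ + i x₂` of a point of `ℝ³`. -/
noncomputable def complexCoord (x : EuclideanSpace ℝ (Fin 3)) : ℂ :=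
  (x 1 : ℂ) + (x 2 : ℂ) * Complex.I

theorem continuous_complexCoord : Continuous complexCoord := by
  unfold complexCoord
  fun_prop

theorem sq_add_normSq_complexCoord (x : EuclideanSpace ℝ (Fin 3)) :
    x 0 ^ 2 + Complex.normSq (complexCoord x) = ‖x‖ ^ 2 := by
  rw [EuclideanSpace.norm_sq_eq, Fin.sum_univ_three, complexCoord, Complex.normSq_add_mul_I]
  simp only [Real.norm_eq_abs, sq_abs]
  ring

/-- The point of `ℝ³` with given height and complex coordinate. -/
noncomputable def pointOfCoord (t : ℝ) (z : ℂ) : EuclideanSpace ℝ (Fin 3) := !₂[t, z.re, z.im]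

theorem complexCoord_pointOfCoord (t : ℝ) (z : ℂ) : complexCoord (pointOfCoord t z) = z := by
  simp [complexCoord, pointOfCoord, Complex.re_add_im]

theorem pointOfCoord_zero (t : ℝ) (z : ℂ) : pointOfCoord t z 0 = t := rfl

theorem norm_pointOfCoord (z : ℂ) (hz : ‖z‖ ≤ 1) (s : ℝ) (hs : s ^ 2 = 1) :
    ‖pointOfCoord (s * √(1 - ‖z‖ ^ 2)) z‖ = 1 := by
  have h := sq_add_normSq_complexCoord (pointOfCoord (s * √(1 - ‖z‖ ^ 2)) z)
  rw [complexCoord_pointOfCoord, pointOfCoord_zero, mul_pow, hs, one_mul,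
    Real.sq_sqrt (by nlinarith [norm_nonneg z]), Complex.normSq_eq_norm_sq] at h
  rw [← sq_eq_sq₀ (norm_nonneg _) zero_le_one, ← h]
  ring

/-- The Hopf line bundle on the two-sphere has no nowhere vanishing section. -/
theorem exists_hopf_section_eq_zero {u₁ u₂ : EuclideanSpace ℝ (Fin 3) → ℂ}
    (hu₁ : Continuous u₁) (hu₂ : Continuous u₂)
    (h₁ : ∀ x, ‖x‖ = 1 → x 0 * u₁ x + star (complexCoord x) * u₂ x = u₁ x)
    (h₂ : ∀ x, ‖x‖ = 1 → complexCoord x * u₁ x - x 0 * u₂ x = u₂ x) :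
    ∃ x, ‖x‖ = 1 ∧ u₁ x = 0 ∧ u₂ x = 0 := by
  by_contra! h0
  -- The radial retraction onto the unit disc, which parametrizes both hemispheres by all of `ℂ`.
  let r : ℂ → ℂ := fun z => ((max 1 ‖z‖)⁻¹ : ℝ) • z
  have hr : Continuous r := by
    have h : Continuous fun z : ℂ => (max 1 ‖z‖)⁻¹ :=
      Continuous.inv₀ (by fun_prop) fun z => by positivity
    exact h.smul continuous_id
  have hr1 : ∀ z, ‖r z‖ ≤ 1 := by
    intro z
    have hpos : 0 < max 1 ‖z‖ := by positivity
    simp only [r]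
    rw [norm_smul, norm_inv, Real.norm_of_nonneg hpos.le, inv_mul_le_one₀ hpos]
    exact le_max_right _ _
  let q : ℝ → ℂ → EuclideanSpace ℝ (Fin 3) := fun s z => pointOfCoord (s * √(1 - ‖r z‖ ^ 2)) (r z)
  have hq : ∀ s, Continuous (q s) := by
    intro s
    refine (PiLp.continuous_toLp 2 _).comp (continuous_pi fun i => ?_)
    fin_cases i <;> simp <;> fun_prop
  have hqn : ∀ s : ℝ, s ^ 2 = 1 → ∀ z, ‖q s z‖ = 1 := fun s hs z => norm_pointOfCoord _ (hr1 z) s hs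
  have hqz : ∀ s z, complexCoord (q s z) = r z := fun s z => complexCoord_pointOfCoord _ _
  have hq0 : ∀ s z, q s z 0 = s * √(1 - ‖r z‖ ^ 2) := fun s z => rfl
  have hupper : ∀ z, u₁ (q 1 z) ≠ 0 := by
    intro z hz
    have hn := hqn 1 (by norm_num) z
    have h := h₂ _ hn
    rw [hz, hq0, mul_zero, zero_sub, one_mul] at h
    refine h0 _ hn hz ?_
    have h3 : ((1 + √(1 - ‖r z‖ ^ 2) : ℝ) : ℂ) * u₂ (q 1 z) = 0 := by
      push_cast
      linear_combination -h
    refine (mul_eq_zero.mp h3).resolve_left ?_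
    exact_mod_cast (by positivity : (1 + √(1 - ‖r z‖ ^ 2) : ℝ) ≠ 0)
  have hlower : ∀ z, u₂ (q (-1) z) ≠ 0 := by
    intro z hz
    have hn := hqn (-1) (by norm_num) z
    have h := h₁ _ hn
    rw [hz, hq0, mul_zero, add_zero, neg_one_mul] at h
    refine h0 _ hn ?_ hz
    have h3 : ((1 + √(1 - ‖r z‖ ^ 2) : ℝ) : ℂ) * u₁ (q (-1) z) = 0 := by
      push_cast at h ⊢
      linear_combination -h
    refine (mul_eq_zero.mp h3).resolve_left ?_
    exact_mod_cast (by positivity : (1 + √(1 - ‖r z‖ ^ 2) : ℝ) ≠ 0)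
  -- The clutching function: on the equator `t = 0`, so `h₂` reads `z u₁ = u₂` and the quotient is
  -- `z`.
  obtain ⟨z, hz⟩ := exists_eq_zero_of_eq_id_on_circle (c := fun z => u₂ (q (-1) z) / u₁ (q 1 z))
    ((hu₂.comp (hq _)).div (hu₁.comp (hq _)) hupper) (by
      intro z hz
      have hrz : r z = z := by simp [r, hz]
      have hqq : q (-1) z = q 1 z := by simp [q, hrz, hz]
      have h := h₂ _ (hqn 1 (by norm_num) z)
      rw [hqz, hrz, hq0, hrz, hz] at h
      rw [hqq, div_eq_iff (hupper z), ← h]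
      simp)
  exact (div_ne_zero (hlower z) (hupper z)) hz

/-- The Hermitian matrix field `[[t, z̄], [z, -t]] ⊕ 0` on `ℝ³ = {(t, z)}`. -/
noncomputable def hedgehog (m : ℕ) (x : EuclideanSpace ℝ (Fin 3)) :
    Matrix (Fin (m + 2)) (Fin (m + 2)) ℂ :=
  Matrix.single 0 0 (x 0 : ℂ) + Matrix.single 0 1 (star (complexCoord x)) +
    Matrix.single 1 0 (complexCoord x) + Matrix.single 1 1 (-(x 0 : ℂ))

theorem continuous_hedgehog (m : ℕ) : Continuous (hedgehog m) := by
  have h := continuous_complexCoord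
  refine continuous_matrix fun i j => ?_
  simp only [hedgehog, Matrix.add_apply, Matrix.single_apply]
  refine ((Continuous.add ?_ ?_).add ?_).add ?_ <;> refine continuous_if_const _ ?_ ?_ <;>
    intro _ <;> fun_prop

theorem isSelfAdjoint_hedgehog (m : ℕ) (x : EuclideanSpace ℝ (Fin 3)) :
    IsSelfAdjoint (hedgehog m x) := by
  rw [IsSelfAdjoint, hedgehog, Matrix.star_eq_conjTranspose]
  simp only [Matrix.conjTranspose_add, Matrix.conjTranspose_single, star_star, star_neg]
  simp
  abel

/-- Since `t² + |z|² = 1`, the square is the projection onto the first two coordinates. -/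
theorem hedgehog_mul_self_mul_self (m : ℕ) {x : EuclideanSpace ℝ (Fin 3)} (hx : ‖x‖ = 1) :
    hedgehog m x * hedgehog m x * hedgehog m x = hedgehog m x := by
  have h1 : (x 0 : ℂ) * x 0 + complexCoord x * star (complexCoord x) = 1 := by
    have := sq_add_normSq_complexCoord x
    rw [hx, one_pow] at this
    rw [Complex.star_def, Complex.mul_conj]
    rw [← Complex.ofReal_mul, ← Complex.ofReal_add, ← sq, this, Complex.ofReal_one]
  have h2 : hedgehog m x * hedgehog m x = Matrix.single 0 0 1 + Matrix.single 1 1 1 := by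
    rw [← h1]
    simp only [hedgehog, add_mul, mul_add, Matrix.single_mul_single_same, ne_eq, zero_ne_one, one_ne_zero,
      not_false_eq_true, Matrix.single_mul_single_of_ne, add_zero, zero_add, Matrix.single_add]
    rw [mul_comm (star (complexCoord x)) (complexCoord x), mul_comm (star (complexCoord x)),
      mul_comm (complexCoord x) (x 0 : ℂ), neg_mul_neg]
    have hneg : ∀ (i j : Fin (m + 2)) (c : ℂ), Matrix.single i j (-c) = -Matrix.single i j c :=
      fun i j c => map_neg (Matrix.singleAddMonoidHom i j) c
    simp only [neg_mul, hneg]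
    abel
  rw [h2]
  simp only [hedgehog, add_mul, mul_add, Matrix.single_mul_single_same, ne_eq, zero_ne_one, one_ne_zero,
      not_false_eq_true, Matrix.single_mul_single_of_ne, add_zero, zero_add, one_mul]

theorem hedgehog_mulVec (m : ℕ) (x : EuclideanSpace ℝ (Fin 3)) (v : Fin (m + 2) → ℂ) :
    Matrix.mulVec (hedgehog m x) v = Pi.single 0 (x 0 * v 0 + star (complexCoord x) * v 1) +
      Pi.single 1 (complexCoord x * v 0 - x 0 * v 1) := by
  simp only [hedgehog, Matrix.add_mulVec, Matrix.single_mulVec_eq]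
  ext i
  simp only [Pi.add_apply, Pi.smul_apply, Pi.single_apply, smul_eq_mul]
  split_ifs <;> ring

/-! ### The obstruction -/

/-- The field `hedgehog` on the unit ball of `ℝ³` cannot be approximated by fields of the form
`∑ β i • p i` with `p i` mutually orthogonal nonzero continuous projection fields. -/
theorem exists_le_norm_sub_sum_smul {Y : Type*} [TopologicalSpace Y] [CompactSpace Y] {m : ℕ}
    (ι : C(EuclideanSpace ℝ (Fin 3), Y)) (a : C(Y, Matrix (Fin (m + 2)) (Fin (m + 2)) ℂ))
    (ha : ∀ x, ‖x‖ ≤ 1 → a (ι x) = hedgehog m x) :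
    ∃ ε : ℝ, 0 < ε ∧ ∀ (β : Fin (m + 2) → C(Y, ℂ))
      (p : Fin (m + 2) → C(Y, Matrix (Fin (m + 2)) (Fin (m + 2)) ℂ)),
      (∀ i, IsStarProjection (p i)) → (∀ i y, (p i y).rank = 1) →
      (∀ i j, i ≠ j → p i * p j = 0) → ε ≤ ‖a - ∑ i, β i • p i‖ := by
  have hK : 0 < (3 * ((m + 2 : ℕ) : ℝ) + 1) + (‖a‖ ^ 2 + 3 * ‖a‖ + 4) := by positivity
  refine ⟨1 / (4 * ((3 * ((m + 2 : ℕ) : ℝ) + 1) + (‖a‖ ^ 2 + 3 * ‖a‖ + 4))), by positivity, ?_⟩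
  set ε := 1 / (4 * ((3 * ((m + 2 : ℕ) : ℝ) + 1) + (‖a‖ ^ 2 + 3 * ‖a‖ + 4))) with hεd
  have hεK : ((3 * ((m + 2 : ℕ) : ℝ) + 1) + (‖a‖ ^ 2 + 3 * ‖a‖ + 4)) * ε = 1 / 4 := by
    rw [hεd]; field_simp
  have hεpos : 0 < ε := by positivity
  have hε1 : (3 * ((m + 2 : ℕ) : ℝ) + 1) * ε < 1 := by
    have : 0 ≤ (‖a‖ ^ 2 + 3 * ‖a‖ + 4) * ε := by positivity
    linarith
  have hε2 : (‖a‖ ^ 2 + 3 * ‖a‖ + 4) * ε < 3 / 8 := by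
    have : 0 ≤ (3 * ((m + 2 : ℕ) : ℝ) + 1) * ε := by positivity
    linarith
  intro β p hp hrank horth
  by_contra! hlt
  let T := Matrix.toEuclideanCLM (n := Fin (m + 2)) (𝕜 := ℂ)
  have hTn : ∀ B, ‖T B‖ = ‖B‖ := Matrix.l2_opNorm_toEuclideanCLM
  have hTc : Continuous T := (AddMonoidHomClass.isometry_of_norm T hTn).continuous
  let P : Fin (m + 2) → EuclideanSpace ℝ (Fin 3) → _ := fun i x => T (p i (ι x))
  have hPi : ∀ i x, P i x * P i x = P i x := fun i x => by
    simp only [P]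
    rw [← map_mul, ← ContinuousMap.mul_apply, (hp i).isIdempotentElem]
  have hPo : ∀ x i j, i ≠ j → P i x * P j x = 0 := fun x i j hij => by
    simp only [P]
    rw [← map_mul, ← ContinuousMap.mul_apply, horth i j hij, ContinuousMap.zero_apply, map_zero]
  have hP1 : ∀ i x, ‖P i x‖ ≤ 1 := fun i x => by
    simp only [P]
    rw [hTn]
    exact ((p i).norm_coe_le_norm _).trans (hp i).norm_le
  have hP0 : ∀ i, P i 0 ≠ 0 := fun i h => by
    have h1 : p i (ι 0) = 0 := (map_eq_zero_iff T T.injective).mp h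
    have h2 := hrank i (ι 0)
    rw [h1, Matrix.rank_zero] at h2
    exact zero_ne_one h2
  let A : EuclideanSpace ℝ (Fin 3) → _ := fun x => T (hedgehog m x)
  have hAc : Continuous A := hTc.comp (continuous_hedgehog m)
  have hA3 : ∀ x, ‖x‖ = 1 → A x * A x * A x = A x := fun x hx => by
    simp only [A]
    rw [← map_mul, ← map_mul, hedgehog_mul_self_mul_self m hx]
  have hAM : ∀ x, ‖x‖ ≤ 1 → ‖A x‖ ≤ ‖a‖ := fun x hx => by
    simp only [A]
    rw [hTn, ← ha x hx]
    exact a.norm_coe_le_norm _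
  have hAB : ∀ x, ‖x‖ ≤ 1 → ‖A x - ∑ i, β i (ι x) • P i x‖ ≤ ε := fun x hx => by
    have h1 : A x - ∑ i, β i (ι x) • P i x = T ((a - ∑ i, β i • p i) (ι x)) := by
      simp [A, P, ha x hx, ContinuousMap.sum_apply]
    rw [h1, hTn]
    exact (ContinuousMap.norm_coe_le_norm _ _).trans hlt.le
  have hAcoord : ∀ x (w : EuclideanSpace ℂ (Fin (m + 2))) k, A x w k =
      ((Pi.single 0 (x 0 * w 0 + star (complexCoord x) * w 1) +
        Pi.single 1 (complexCoord x * w 0 - x 0 * w 1) : Fin (m + 2) → ℂ)) k := fun x w k => by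
    rw [← hedgehog_mulVec]
    rfl
  -- At the pole the matrix is `diag(1, -1, 0, …)`.
  let x₀ : EuclideanSpace ℝ (Fin 3) := pointOfCoord 1 0
  have hx₀ : ‖x₀‖ = 1 := by
    have := norm_pointOfCoord 0 (by simp) 1 (by simp)
    simpa [x₀] using this
  obtain ⟨i, hi⟩ := exists_coeff_near_one (A := A x₀) (p := fun i => P i x₀)
    (β := fun i => β i (ι x₀)) (fun i => hPi i x₀) (hPo x₀) (fun i => hP1 i x₀) (hAB x₀ hx₀.le) hε1
    (e := EuclideanSpace.single 0 1) (by simp) (by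
      ext k
      rw [hAcoord, complexCoord_pointOfCoord, pointOfCoord_zero]
      simp [Pi.single_apply])
  have hPc : Continuous (P i) := hTc.comp ((p i).continuous.comp ι.continuous)
  obtain ⟨v, hv, hPv, hv0⟩ := exists_nonvanishing_section hPc (hPi i) (hP0 i)
  have hAv : ∀ x, ‖x‖ ≤ 1 → ‖A x (v x) - β i (ι x) • v x‖ ≤ ε * ‖v x‖ := fun x hx => by
    have h1 : (∑ j, β j (ι x) • P j x) (v x) = β i (ι x) • v x := by
      rw [sum_apply, Finset.sum_eq_single i]
      · rw [smul_apply, hPv]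
      · intro j _ hj
        have := DFunLike.congr_fun (hPo x j i hj) (v x)
        change P j x (P i x (v x)) = 0 at this
        rw [hPv] at this
        rw [smul_apply, this, smul_zero]
      · simp
    rw [← h1, ← sub_apply]
    exact (ContinuousLinearMap.le_opNorm _ _).trans (by gcongr; exact hAB x hx)
  have hβ : ∀ x, ‖x‖ = 1 → ‖β i (ι x) - 1‖ < 1 / 2 := by
    intro x hx
    by_contra! hge
    have hcon : IsPreconnected (Metric.sphere (0 : EuclideanSpace ℝ (Fin 3)) 1) :=
      isPreconnected_sphere (by rw [rank_eq_card_basis (EuclideanSpace.basisFun _ ℝ).toBasis]; simp) 0 1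
    have hcont : Continuous fun x => ‖β i (ι x) - 1‖ := by fun_prop
    obtain ⟨y, hy, hy2⟩ := hcon.intermediate_value (by simpa using hx₀) (by simpa using hx)
      hcont.continuousOn ⟨hi.le, hge⟩
    have hy1 : ‖y‖ = 1 := by simpa using hy
    exact norm_sub_one_ne_half (hA3 y hy1) (hAM y hy1.le) hε2 (hv0 y hy1.le) (hAv y hy1.le) hy2
  -- `A² + A` maps into the 1-eigenspace because `A³ = A`.
  let w : EuclideanSpace ℝ (Fin 3) → EuclideanSpace ℂ (Fin (m + 2)) :=
    fun x => A x (A x (v x)) + A x (v x)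
  have hwc : Continuous w := by fun_prop
  have hwk : ∀ k, Continuous fun x => w x k := fun k => by fun_prop
  have hAw : ∀ x, ‖x‖ = 1 → A x (w x) = w x := fun x hx => by
    have h := DFunLike.congr_fun (hA3 x hx) (v x)
    change A x (A x (A x (v x))) = A x (v x) at h
    simp only [w, map_add, h]
    abel
  obtain ⟨x, hx, h0, h1⟩ := exists_hopf_section_eq_zero (hwk 0) (hwk 1)
    (fun x hx => by
      conv_rhs => rw [← hAw x hx, hAcoord]
      simp)
    (fun x hx => by
      conv_rhs => rw [← hAw x hx, hAcoord]
      simp)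
  refine sq_add_self_apply_ne_zero (hAM x hx.le) hε2 (hv0 x hx.le) (hAv x hx.le) (hβ x hx) ?_
  change w x = 0
  rw [← hAw x hx]
  ext k
  rw [hAcoord, h0, h1]
  simp

/-! ### Construction of the homomorphism -/

/-- A CW complex of dimension at least `k > 0` contains an injective continuous image of `ℝ^k`. -/
theorem exists_injective_of_le_cwDim {X : Type*} [TopologicalSpace X] {C : Set X} [CWComplex C]
    {k : ℕ} (hk0 : k ≠ 0) (hk : ((k : ℕ∞) : WithBot ℕ∞) ≤ cwDim C) :
    ∃ f : C(Fin k → ℝ, X), Function.Injective f := by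
  -- A strict lower bound on the supremum is exceeded by an actual cell.
  have hlt : (((k - 1 : ℕ) : ℕ∞) : WithBot ℕ∞) < cwDim C := by
    refine lt_of_lt_of_le ?_ hk
    exact_mod_cast Nat.sub_one_lt hk0
  obtain ⟨d, hd⟩ := lt_iSup_iff.mp hlt
  obtain ⟨⟨e⟩, hd⟩ := lt_iSup_iff.mp hd
  have hkd : k - 1 < d := by exact_mod_cast hd
  obtain ⟨L, hL, hLi⟩ := exists_continuous_injective_pad (k := k) (d := d) (by omega)
  exact exists_injective_of_cell e L hL hLi

theorem theorem7p8 {Y : Type*} [TopologicalSpace Y] [T2Space Y]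
    [CWComplex (Set.univ : Set Y)] [RelCWComplex.Finite (Set.univ : Set Y)]
    (hY : 3 < cwDim (Set.univ : Set Y)) (n : ℕ) (hn : 2 ≤ n)
    {X : Type*} [TopologicalSpace X] [T2Space X]
    [CWComplex (Set.univ : Set X)] [RelCWComplex.Finite (Set.univ : Set X)]
    (hX : 1 ≤ cwDim (Set.univ : Set X)) :
    ∃ φ : C(X, ℂ) →⋆ₐ[ℂ] C(Y, Matrix (Fin n) (Fin n) ℂ), ¬ IsApproxDiagonalizable φ := by
  obtain ⟨m, rfl⟩ : ∃ m, n = m + 2 := ⟨n - 2, by omega⟩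
  obtain ⟨f₃, hf₃⟩ := exists_injective_of_le_cwDim (k := 3) three_ne_zero hY.le
  obtain ⟨f₁, hf₁⟩ := exists_injective_of_le_cwDim (k := 1) one_ne_zero hX
  let ι : C(EuclideanSpace ℝ (Fin 3), Y) := f₃.comp ⟨_, PiLp.continuous_ofLp 2 _⟩
  have hι : Function.Injective ι := hf₃.comp (WithLp.ofLp_injective 2)
  let j : C(ℝ, X) := f₁.comp ⟨fun s _ => s, by fun_prop⟩
  have hj : Function.Injective j := fun s t h => congrFun (hf₁ h) 0
  obtain ⟨h, hh⟩ := exists_leftInverse_on_compact ι hι (isCompact_closedBall 0 1)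
  let a : C(Y, Matrix (Fin (m + 2)) (Fin (m + 2)) ℂ) :=
    ⟨fun y => hedgehog m (h y), (continuous_hedgehog m).comp h.continuous⟩
  have ha : IsSelfAdjoint a := ContinuousMap.ext fun y => isSelfAdjoint_hedgehog m (h y)
  -- The radius makes the interval contain the spectrum of `a`.
  obtain ⟨g, hg⟩ := exists_leftInverse_on_compact j hj
    (isCompact_closedBall 0 (‖a‖ * ‖(1 : C(Y, Matrix (Fin (m + 2)) (Fin (m + 2)) ℂ))‖))
  obtain ⟨ε, hε, hlow⟩ := exists_le_norm_sub_sum_smul ι a fun x hx => by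
    change hedgehog m (h (ι x)) = _
    rw [hh x (by simpa using hx)]
  -- Pull functions back along the arc to the spectrum of `a`, then apply functional calculus; `g'`
  -- pulls back to the identity.
  let φ : C(X, ℂ) →⋆ₐ[ℂ] C(Y, Matrix (Fin (m + 2)) (Fin (m + 2)) ℂ) :=
    (cfcHom (R := ℂ) ha.isStarNormal).comp
      (ContinuousMap.compStarAlgHom' ℂ ℂ ⟨fun z : spectrum ℂ a => j (z : ℂ).re, by fun_prop⟩)
  let g' : C(X, ℂ) := ⟨fun x => (g x : ℂ), by fun_prop⟩
  have hφ : φ g' = a := by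
    conv_rhs => rw [← cfcHom_id (R := ℂ) ha.isStarNormal]
    refine congrArg (cfcHom (R := ℂ) ha.isStarNormal) (ContinuousMap.ext fun z => ?_)
    change ((g (j (z : ℂ).re) : ℝ) : ℂ) = z
    rw [hg, ← ha.mem_spectrum_eq_re z.2]
    have := spectrum.norm_le_norm_mul_of_mem z.2
    rw [mem_closedBall_zero_iff]
    exact (Complex.abs_re_le_norm _).trans this
  refine ⟨φ, fun hdiag => ?_⟩
  obtain ⟨α, p, hp, hr, ho, hlt⟩ := hdiag ε hε {g'} isCompact_singleton
  have hlt := hlt g' rfl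
  rw [hφ] at hlt
  exact absurd (hlow (fun i => g'.comp (α i)) p hp hr ho) hlt.not_ge
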